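/- Let $(X,\rho)$ be a compact metric space and let $T\colon X\to X$ be continuous and surjective. A finite family of orbit segments $\xi=\{T^{[a_j,b_j]}(x_j)\}_{j=1}^n$, $n\ge 1$, where $x_j\in X$, $a_j\le b_j$ are nonnegative integers and $T^{[a,b]}(x)=(T^a(x),\ldots,T^b(x))$, is called an $M$-spaced specification, for a function $M$ from the positive integers to the nonnegative integers, if $a_i-b_{i-1}\ge M(b_i-a_i+1)$ for $2\le i\le n$. It is $\varepsilon$-traced by $y\in X$ if $\rho(T^k(y),T^k(x_i))\le\varepsilon$ for all $1\le i\le n$ and $a_i\le k\le b_i$. Suppose that $(X,T)$ has the weak specification property: for every $\varepsilon>0$ there is a nondecreasing function $M_\varepsilon$ from the positive integers to the nonnegative integers with $M_\varepsilon(n)/n\to 0$ as $n\to\infty$ such that every $M_\varepsilon$-spaced specification is $\varepsilon$-traced by some point of $X$. Then $(X,T)$ has the asymptotic average shadowing property: for every sequence $\{x_n\}_{n=0}^\infty$ in $X$ with $$\lim_{N\to\infty}\frac1N\sum_{n=0}^{N-1}\rho\big(T(x_n),x_{n+1}\big)=0$$ there is a point $z\in X$ with $$\lim_{N\to\infty}\frac1N\sum_{n=0}^{N-1}\rho\big(T^n(z),x_n\big)=0.$$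 -/

import Mathlib

open Filter Topology

namespace AverageShadowing

/-- A sequence `x` is an asymptotic average pseudo-orbit for `T` if
`(1 / N) * ∑_{n < N} ρ(T (x n), x (n + 1))` tends to `0`. -/
def IsAsymptoticAveragePseudoOrbit {X : Type*} [MetricSpace X] (T : X → X) (x : ℕ → X) : Prop :=
  Tendsto (fun N : ℕ => (1 / (N : ℝ)) * ∑ n ∈ Finset.range N, dist (T (x n)) (x (n + 1)))
    atTop (𝓝 0)

/-- The sequence `x` is asymptotically shadowed in average by the point `z` if
`(1 / N) * ∑_{n < N} ρ(T^n z, x n)` tends to `0`. -/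
def IsAsymptoticallyShadowedInAverage {X : Type*} [MetricSpace X] (T : X → X) (x : ℕ → X)
    (z : X) : Prop :=
  Tendsto (fun N : ℕ => (1 / (N : ℝ)) * ∑ n ∈ Finset.range N, dist (T^[n] z) (x n))
    atTop (𝓝 0)

/-- The asymptotic average shadowing property. -/
def HasAsymptoticAverageShadowing {X : Type*} [MetricSpace X] (T : X → X) : Prop :=
  ∀ x : ℕ → X, IsAsymptoticAveragePseudoOrbit T x →
    ∃ z : X, IsAsymptoticallyShadowedInAverage T x z

/-- The data `(x, [a, b])`, `a ≤ b`, of an orbit segment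
`T^{[a, b]}(x) = (T^a x, T^(a+1) x, …, T^b x)`. -/
structure OrbitSegment (X : Type*) where
  /-- the point whose orbit is followed -/
  point : X
  /-- the first time of the segment -/
  first : ℕ
  /-- the last time of the segment -/
  last : ℕ
  /-- the time interval is nonempty -/
  first_le_last : first ≤ last

/-- The number `b - a + 1` of terms of an orbit segment over `[a, b]`. -/
def OrbitSegment.length {X : Type*} (s : OrbitSegment X) : ℕ :=
  s.last - s.first + 1

/-- A finite family of orbit segments over `[a_i, b_i]` is an `M`-spaced specification if
`a_i - b_{i-1} ≥ M (b_i - a_i + 1)` (as integers) for every index `i` but the first. -/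
def IsSpacedSpecification {X : Type*} (M : ℕ → ℕ) {n : ℕ} (ξ : Fin n → OrbitSegment X) : Prop :=
  ∀ i j : Fin n, (i : ℕ) + 1 = (j : ℕ) → (ξ i).last + M (ξ j).length ≤ (ξ j).first

/-- The family `ξ` is `ε`-traced by `y`: `ρ(T^k y, T^k x_i) ≤ ε` whenever `a_i ≤ k ≤ b_i`. -/
def IsTracedBy {X : Type*} [MetricSpace X] (T : X → X) (ε : ℝ) {n : ℕ}
    (ξ : Fin n → OrbitSegment X) (y : X) : Prop :=
  ∀ i : Fin n, ∀ k : ℕ, (ξ i).first ≤ k → k ≤ (ξ i).last →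
    dist (T^[k] y) (T^[k] (ξ i).point) ≤ ε

/-- The weak specification property: for each `ε > 0` there is a nondecreasing gap function `M`
with `M n / n → 0` such that every (nonempty, finite) `M`-spaced specification is `ε`-traced by
some point. Replacing `M` by `max M 1`, it does not matter whether `M` may take the value `0`. -/
def HasWeakSpecification {X : Type*} [MetricSpace X] (T : X → X) : Prop :=
  ∀ ε : ℝ, 0 < ε → ∃ M : ℕ → ℕ, Monotone M ∧
    Tendsto (fun n : ℕ => (M n : ℝ) / (n : ℝ)) atTop (𝓝 0) ∧
    ∀ (n : ℕ), 1 ≤ n → ∀ ξ : Fin n → OrbitSegment X, IsSpacedSpecification M ξ →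
      ∃ y : X, IsTracedBy T ε ξ y

end AverageShadowing

/-!
A pseudo-orbit `x` with small average error stays, over most time windows of a fixed length `L`,
close to the true orbit segment issuing from the beginning of the window. Weak specification
allows one to choose `L` so large that these segments can be traced one after the other with gaps
of negligible density, after an arbitrary initial orbit segment. So, up to any prescribed time, an
orbit can be modified from a late moment `N₁` on so as to follow `x` with small average error,
while hardly moving before `N₁`. Doing this along rapidly increasing times with summable tolerances
yields a Cauchy sequence of points, whose limit shadows `x` in average.
-/

namespace AverageShadowing

open Asymptotics

theorem tendsto_average_iff_isLittleO {S : ℕ → ℝ} :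
    Tendsto (fun N : ℕ => (1 / (N : ℝ)) * S N) atTop (𝓝 0) ↔
      S =o[atTop] fun N : ℕ => (N : ℝ) := by
  rw [isLittleO_iff_tendsto' ((eventually_ne_atTop 0).mono fun N hN h =>
    absurd (Nat.cast_eq_zero.1 h) hN)]
  simp only [one_div_mul_eq_div]

theorem sum_range_sum_Ico_sub_le {e : ℕ → ℝ} (he : ∀ n, 0 ≤ e n) (L N : ℕ) :
    ∑ n ∈ Finset.range N, ∑ i ∈ Finset.Ico (n - L) n, e i ≤ L * ∑ i ∈ Finset.range N, e i := by
  have hswap : ∑ n ∈ Finset.range N, ∑ i ∈ Finset.Ico (n - L) n, e i =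
      ∑ i ∈ Finset.range N, ∑ _n ∈ (Finset.Ioc i (i + L)).filter (· < N), e i :=
    Finset.sum_comm' fun n i => by
      simp only [Finset.mem_range, Finset.mem_Ico, Finset.mem_filter, Finset.mem_Ioc]
      omega
  rw [hswap, Finset.mul_sum]
  refine Finset.sum_le_sum fun i _ => ?_
  have hcard : ((Finset.Ioc i (i + L)).filter (· < N)).card ≤ L :=
    (Finset.card_filter_le _ _).trans (by simp)
  rw [Finset.sum_const, nsmul_eq_mul]
  exact mul_le_mul_of_nonneg_right (Nat.cast_le.2 hcard) (he i)

theorem card_filter_mod_lt_le (P m n : ℕ) :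
    ((Finset.range n).filter fun k => k % P < m).card ≤ (n / P + 1) * m := by
  refine (Finset.card_le_card_of_injOn (t := Finset.range (n / P + 1) ×ˢ Finset.range m)
    (fun k => (k / P, k % P)) (fun k hk => ?_) fun k _ l _ h => ?_).trans_eq (by simp)
  · simp only [Finset.coe_filter, Finset.mem_range, Set.mem_ofPred_eq] at hk
    simp only [Finset.coe_product, Set.mem_prod, Finset.mem_coe, Finset.mem_range]
    exact ⟨Nat.lt_succ_of_le (Nat.div_le_div_right hk.1.le), hk.2⟩
  · simp only [Prod.mk.injEq] at h
    rw [← Nat.div_add_mod k P, ← Nat.div_add_mod l P, h.1, h.2]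

theorem card_filter_mod_add_lt_le {L m : ℕ} {η : ℝ} (hη : 0 ≤ η) (hm : (m : ℝ) ≤ η * L) (n : ℕ) :
    (((Finset.range n).filter fun k => k % (L + m) < m).card : ℝ) ≤ η * n + m := by
  have hperiods : n / (L + m) * L ≤ n :=
    (Nat.mul_le_mul_left _ (Nat.le_add_right L m)).trans (Nat.div_mul_le_self n _)
  calc (((Finset.range n).filter fun k => k % (L + m) < m).card : ℝ)
      ≤ ((n / (L + m) : ℕ) + 1) * m := by exact_mod_cast card_filter_mod_lt_le (L + m) m n
    _ = (n / (L + m) : ℕ) * m + m := by ring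
    _ ≤ (n / (L + m) : ℕ) * (η * L) + m := by gcongr
    _ = η * ((n / (L + m) * L : ℕ) : ℝ) + m := by push_cast; ring
    _ ≤ η * n + m := by gcongr

theorem sum_Ico_ite_mod_lt_le {L m : ℕ} {η D : ℝ} (hη : 0 ≤ η) (hD : 0 ≤ D)
    (hm : (m : ℝ) ≤ η * L) (a b : ℕ) :
    ∑ n ∈ Finset.Ico a b, (if (n - a) % (L + m) < m then D else 0) ≤ D * (η * b + m) := by
  rw [Finset.sum_Ico_eq_sum_range]
  simp only [Nat.add_sub_cancel_left]
  rw [← Finset.sum_filter, Finset.sum_const, nsmul_eq_mul, mul_comm]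
  have hba : ((b - a : ℕ) : ℝ) ≤ b := Nat.cast_le.2 (Nat.sub_le b a)
  calc D * (((Finset.range (b - a)).filter fun k => k % (L + m) < m).card : ℝ)
      ≤ D * (η * (b - a : ℕ) + m) := by gcongr; exact card_filter_mod_add_lt_le hη hm _
    _ ≤ D * (η * b + m) := by gcongr

theorem sum_Ico_le_of_forall_le_gap_add_window {d e : ℕ → ℝ} {c C D η : ℝ} {a b L m : ℕ}
    (hc : 0 ≤ c) (hC : 0 ≤ C) (hD : 0 ≤ D) (hη : 0 ≤ η) (hm : (m : ℝ) ≤ η * L) (he : ∀ n, 0 ≤ e n)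
    (hd : ∀ n ∈ Finset.Ico a b, d n ≤
      c + (if (n - a) % (L + m) < m then D else 0) + C * ∑ i ∈ Finset.Ico (n - L) n, e i) :
    ∑ n ∈ Finset.Ico a b, d n ≤
      c * b + D * (η * b + m) + C * (L * ∑ n ∈ Finset.range b, e n) := by
  have hconst : ((b - a : ℕ) : ℝ) * c ≤ c * b := by
    rw [mul_comm]
    gcongr
    exact Nat.sub_le b a
  have hwindows : ∑ n ∈ Finset.Ico a b, ∑ i ∈ Finset.Ico (n - L) n, e i ≤
      L * ∑ n ∈ Finset.range b, e n :=
    (Finset.sum_le_sum_of_subset_of_nonneg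
      (fun n hn => Finset.mem_range.2 (Finset.mem_Ico.1 hn).2)
      fun n _ _ => Finset.sum_nonneg fun i _ => he i).trans (sum_range_sum_Ico_sub_le he L b)
  refine (Finset.sum_le_sum hd).trans ?_
  rw [Finset.sum_add_distrib, Finset.sum_add_distrib, Finset.sum_const, Nat.card_Ico,
    nsmul_eq_mul, ← Finset.mul_sum]
  gcongr
  exact sum_Ico_ite_mod_lt_le hη hD hm a b

theorem sum_range_le_of_sum_Ico_le {d : ℕ → ℝ} {D η₁ η₂ : ℝ} (hD : 0 ≤ D) (hdD : ∀ n, d n ≤ D)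
    {a b N : ℕ} (hab : a ≤ b) (hbN : b ≤ N) (hη₁ : 0 ≤ η₁) (ha : (a : ℝ) ≤ η₁ * b)
    (hsum₁ : ∑ n ∈ Finset.Ico a b, d n ≤ η₁ * b) (hsum₂ : ∑ n ∈ Finset.Ico b N, d n ≤ η₂ * N) :
    ∑ n ∈ Finset.range N, d n ≤ ((D + 1) * η₁ + η₂) * N := by
  have hinitial : ∑ n ∈ Finset.range a, d n ≤ a * D := by
    simpa using Finset.sum_le_card_nsmul (Finset.range a) d D fun n _ => hdD n
  rw [← Finset.sum_range_add_sum_Ico d hbN, ← Finset.sum_range_add_sum_Ico d hab]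
  calc _ ≤ η₁ * b * D + η₁ * b + η₂ * N := by
        gcongr
        exact hinitial.trans (by gcongr)
    _ = (D + 1) * η₁ * b + η₂ * N := by ring
    _ ≤ (D + 1) * η₁ * N + η₂ * N := by gcongr
    _ = _ := by ring

theorem isLittleO_sum_range_of_sum_Ico_le {d : ℕ → ℝ} {D : ℝ} (hd : ∀ n, 0 ≤ d n)
    (hdD : ∀ n, d n ≤ D) {t : ℕ → ℕ} (ht : StrictMono t) {η : ℕ → ℝ}
    (hη : Tendsto η atTop (𝓝 0)) (hgrow : ∀ k, (t k : ℝ) ≤ η k * t (k + 1))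
    (hblock : ∀ k, ∀ N ∈ Set.Icc (t k) (t (k + 1)), ∑ n ∈ Finset.Ico (t k) N, d n ≤ η k * N) :
    (fun N => ∑ n ∈ Finset.range N, d n) =o[atTop] fun N : ℕ => (N : ℝ) := by
  have hD : 0 ≤ D := (hd 0).trans (hdD 0)
  have hη0 : ∀ k, 0 ≤ η k := fun k =>
    nonneg_of_mul_nonneg_left ((Nat.cast_nonneg (t k)).trans (hgrow k))
      (Nat.cast_pos.2 ((Nat.zero_le _).trans_lt (ht k.lt_succ_self)))
  have htwo_blocks : ∀ k, ∀ N ∈ Set.Icc (t (k + 1)) (t (k + 2)),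
      ∑ n ∈ Finset.range N, d n ≤ ((D + 1) * η k + η (k + 1)) * N := fun k N hN =>
    have hle : t k ≤ t (k + 1) := ht.monotone k.le_succ
    sum_range_le_of_sum_Ico_le hD hdD hle hN.1 (hη0 k) (hgrow k) (hblock k _ ⟨hle, le_rfl⟩)
      (hblock (k + 1) N hN)
  have hlim : Tendsto (fun k => (D + 1) * η k + η (k + 1)) atTop (𝓝 0) := by
    simpa using (hη.const_mul (D + 1)).add (hη.comp (tendsto_add_atTop_nat 1))
  refine isLittleO_iff.2 fun c hc => ?_
  obtain ⟨K, hK⟩ := eventually_atTop.1 (hlim.eventually_le_const hc)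
  filter_upwards [eventually_gt_atTop (t (K + 1))] with N hN
  have htK : StrictMono fun j => t (K + 1 + j) := ht.comp (strictMono_id.const_add (K + 1))
  obtain ⟨j, hjN, hNj⟩ := htK.exists_between_of_tendsto_atTop htK.tendsto_atTop hN
  rw [Real.norm_of_nonneg (Finset.sum_nonneg fun n _ => hd n), Real.norm_natCast]
  refine (htwo_blocks (K + j) N ⟨?_, ?_⟩).trans
    (mul_le_mul_of_nonneg_right (hK _ (Nat.le_add_right K j)) (Nat.cast_nonneg N))
  · exact (show t (K + j + 1) = t (K + 1 + j) by ring_nf).trans_le hjN.le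
  · exact hNj.trans_eq (by ring_nf)

theorem exists_strictMono_forall_and_mul_le {P : ℕ → ℕ → Prop} (hP : ∀ k, ∀ᶠ n in atTop, P k n)
    (c : ℕ → ℕ) : ∃ t : ℕ → ℕ, StrictMono t ∧ (∀ k, P k (t k)) ∧ ∀ k, c k * t k ≤ t (k + 1) := by
  choose N hN using fun k => eventually_atTop.1 (hP k)
  obtain ⟨t, ht_zero, ht_succ⟩ : ∃ t : ℕ → ℕ, t 0 = N 0 ∧
      ∀ k, t (k + 1) = N (k + 1) + c k * t k + t k + 1 :=
    ⟨fun k => Nat.rec (N 0) (fun k s => N (k + 1) + c k * s + s + 1) k, rfl, fun _ => rfl⟩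
  refine ⟨t, strictMono_nat_of_lt_succ fun k => by rw [ht_succ]; omega, fun k => hN k _ ?_,
    fun k => by rw [ht_succ]; omega⟩
  cases k with
  | zero => exact ht_zero.ge
  | succ k => rw [ht_succ]; omega

section BoundedSpaces

theorem exists_pos_forall_dist_le (X : Type*) [PseudoMetricSpace X] [BoundedSpace X] :
    ∃ D : ℝ, 0 < D ∧ ∀ u v : X, dist u v ≤ D := by
  obtain ⟨D, hD⟩ := Metric.isBounded_iff.1 (Bornology.IsBounded.all (Set.univ : Set X))
  exact ⟨max D 1, by positivity, fun u v =>
    (hD (Set.mem_univ u) (Set.mem_univ v)).trans (le_max_left _ _)⟩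

theorem exists_dist_map_le_add_mul_dist {X Y : Type*} [PseudoMetricSpace X] [PseudoMetricSpace Y]
    [BoundedSpace Y] {f : X → Y} (hf : UniformContinuous f) {ε : ℝ} (hε : 0 < ε) :
    ∃ C : ℝ, 0 ≤ C ∧ ∀ u v : X, dist (f u) (f v) ≤ ε + C * dist u v := by
  obtain ⟨D, hD_pos, hD⟩ := exists_pos_forall_dist_le Y
  obtain ⟨δ, hδ, hclose⟩ := Metric.uniformContinuous_iff.1 hf ε hε
  refine ⟨D / δ, by positivity, fun u v => ?_⟩
  rcases lt_or_ge (dist u v) δ with huv | huv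
  · exact (hclose huv).le.trans (le_add_of_nonneg_right (by positivity))
  · calc dist (f u) (f v) ≤ D := hD _ _
      _ = D / δ * δ := (div_mul_cancel₀ D hδ.ne').symm
      _ ≤ D / δ * dist u v := by gcongr
      _ ≤ ε + D / δ * dist u v := le_add_of_nonneg_left hε.le

variable {X : Type*} [PseudoMetricSpace X] [BoundedSpace X] {T : X → X}

theorem exists_dist_iterate_le_add_mul_dist (hT : UniformContinuous T) (L : ℕ) {ε : ℝ}
    (hε : 0 < ε) : ∃ C : ℝ, 0 ≤ C ∧ ∀ k < L, ∀ u v : X,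
      dist (T^[k] u) (T^[k] v) ≤ ε + C * dist u v := by
  have hiterates : UniformContinuous fun (u : X) (k : Fin L) => T^[k] u :=
    uniformContinuous_pi.2 fun k => hT.iterate T k
  obtain ⟨C, hC, h⟩ := exists_dist_map_le_add_mul_dist hiterates hε
  exact ⟨C, hC, fun k hk u v => (dist_le_pi_dist (fun k : Fin L => T^[k] u) (fun k => T^[k] v)
    ⟨k, hk⟩).trans (h u v)⟩

theorem exists_dist_iterate_le_add_mul_sum (hT : UniformContinuous T) (L : ℕ) {ε : ℝ}
    (hε : 0 < ε) : ∃ C : ℝ, 0 ≤ C ∧ ∀ x : ℕ → X, ∀ a, ∀ j ≤ L,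
      dist (T^[j] (x a)) (x (a + j)) ≤
        ε + C * ∑ i ∈ Finset.Ico a (a + j), dist (T (x i)) (x (i + 1)) := by
  obtain ⟨C, hC, hiter⟩ := exists_dist_iterate_le_add_mul_dist hT L
    (show 0 < ε / (L + 1) by positivity)
  refine ⟨C, hC, fun x a j hj => ?_⟩
  have hstep : ∀ i < j, dist (T^[j - i] (x (a + i))) (T^[j - (i + 1)] (x (a + (i + 1)))) ≤
      ε / (L + 1) + C * dist (T (x (a + i))) (x (a + i + 1)) := by
    intro i hi
    rw [show j - i = j - (i + 1) + 1 by omega, Function.iterate_succ_apply, ← add_assoc]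
    exact hiter _ (by omega) _ _
  have hjL : j * (ε / (L + 1)) ≤ ε := by
    rw [mul_div_assoc', div_le_iff₀ (by positivity), mul_comm]
    gcongr
    exact_mod_cast hj.trans L.le_succ
  calc dist (T^[j] (x a)) (x (a + j))
      ≤ ∑ i ∈ Finset.range j, dist (T^[j - i] (x (a + i))) (T^[j - (i + 1)] (x (a + (i + 1)))) := by
        simpa using dist_le_range_sum_dist (fun i => T^[j - i] (x (a + i))) j
    _ ≤ ∑ i ∈ Finset.range j, (ε / (L + 1) + C * dist (T (x (a + i))) (x (a + i + 1))) :=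
        Finset.sum_le_sum fun i hi => hstep i (Finset.mem_range.1 hi)
    _ = j * (ε / (L + 1)) + C * ∑ i ∈ Finset.range j, dist (T (x (a + i))) (x (a + i + 1)) := by
        simp [Finset.sum_add_distrib, Finset.mul_sum]
    _ ≤ ε + C * ∑ i ∈ Finset.range j, dist (T (x (a + i))) (x (a + i + 1)) := by gcongr
    _ = _ := by rw [Finset.sum_Ico_eq_sum_range, Nat.add_sub_cancel_left]

end BoundedSpaces

theorem exists_forall_dist_iterate_le_of_dist_succ_le {X : Type*} [PseudoMetricSpace X]
    [CompleteSpace X] {T : X → X} (hT : Continuous T) {t : ℕ → ℕ} (ht : Monotone t) {z : ℕ → X}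
    (hz : ∀ k, ∀ n ≤ t k, dist (T^[n] (z (k + 1))) (T^[n] (z k)) ≤ (1 / 2) ^ k) :
    ∃ y : X, ∀ k, ∀ n ≤ t k, dist (T^[n] (z k)) (T^[n] y) ≤ 2 * (1 / 2) ^ k := by
  obtain ⟨y, hy⟩ := cauchySeq_tendsto_of_complete (cauchySeq_of_le_geometric (f := z) (1 / 2) 1
    (by norm_num) fun k => by simpa [dist_comm] using hz k 0 (Nat.zero_le _))
  refine ⟨y, fun k n hn => ?_⟩
  have hconv : Tendsto (fun j => T^[n] (z (j + k))) atTop (𝓝 (T^[n] y)) :=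
    (((hT.iterate n).tendsto y).comp hy).comp (tendsto_add_atTop_nat k)
  have hstep : ∀ j, dist (T^[n] (z (j + k))) (T^[n] (z (j + 1 + k))) ≤
      (1 / 2) ^ k * (1 / 2) ^ j := fun j => by
    rw [dist_comm, add_right_comm, ← pow_add, add_comm k j]
    exact hz (j + k) n (hn.trans (ht (Nat.le_add_left k j)))
  have hdist := dist_le_of_le_geometric_of_tendsto₀ _ _ (by norm_num) hstep hconv
  rw [zero_add] at hdist
  exact hdist.trans_eq (by ring)

variable {X : Type*} [MetricSpace X] {T : X → X}

/-- Every nonempty finite `M`-spaced specification is `ε`-traced by some point: the weak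
specification property at a single scale `ε`, with `M` as its gap function. -/
def TracesSpacedSpecifications (T : X → X) (ε : ℝ) (M : ℕ → ℕ) : Prop :=
  ∀ n : ℕ, 1 ≤ n → ∀ ξ : Fin n → OrbitSegment X, IsSpacedSpecification M ξ →
    ∃ y : X, IsTracedBy T ε ξ y

section Tracing

variable {ε : ℝ} {M : ℕ → ℕ}

theorem TracesSpacedSpecifications.exists_forall_dist_iterate_le
    (hM : TracesSpacedSpecifications T ε M) (ξ : ℕ → OrbitSegment X)
    (hξ : ∀ i, (ξ i).last + M (ξ (i + 1)).length ≤ (ξ (i + 1)).first) (K : ℕ) :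
    ∃ y : X, ∀ i ≤ K, ∀ k, (ξ i).first ≤ k → k ≤ (ξ i).last →
      dist (T^[k] y) (T^[k] (ξ i).point) ≤ ε := by
  obtain ⟨y, hy⟩ := hM (K + 1) (Nat.le_add_left 1 K) (fun i => ξ i) fun i j hij => by
    simpa only [← hij] using hξ i
  exact ⟨y, fun i hi => hy ⟨i, Nat.lt_succ_of_le hi⟩⟩

theorem TracesSpacedSpecifications.exists_tracing_periodic_blocks
    (hM : TracesSpacedSpecifications T ε M) (hsurj : Function.Surjective T) {L : ℕ} (hL : 0 < L)
    (x : ℕ → X) (z : X) (N K : ℕ) :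
    ∃ y : X, (∀ k ≤ N, dist (T^[k] y) (T^[k] z) ≤ ε) ∧
      ∀ i < K, ∀ j < L, dist (T^[N + i * (L + M L) + M L + j] y)
        (T^[j] (x (N + i * (L + M L) + M L))) ≤ ε := by
  -- Segments are indexed by absolute time, so following `x a` from time `a` on means following
  -- the orbit of a preimage of `x a` under `T^[a]`.
  choose w hw using fun a : ℕ => hsurj.iterate a (x a)
  let a : ℕ → ℕ := fun i => N + i * (L + M L) + M L
  let ξ : ℕ → OrbitSegment X
    | 0 => ⟨z, 0, N, N.zero_le⟩
    | i + 1 => ⟨w (a i), a i, a i + (L - 1), Nat.le_add_right _ _⟩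
  have hlength : ∀ i, (ξ (i + 1)).length = L := fun i => by
    simp only [ξ, OrbitSegment.length]
    omega
  have hspaced : ∀ i, (ξ i).last + M (ξ (i + 1)).length ≤ (ξ (i + 1)).first := by
    intro i
    rw [hlength]
    cases i with
    | zero => simp [ξ, a]
    | succ i =>
      simp only [ξ, a, add_one_mul]
      omega
  obtain ⟨y, hy⟩ := hM.exists_forall_dist_iterate_le ξ hspaced K
  refine ⟨y, fun k hk => hy 0 K.zero_le k k.zero_le hk, fun i hi j hj => ?_⟩
  have htrace : dist (T^[a i + j] y) (T^[a i + j] (w (a i))) ≤ ε :=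
    hy (i + 1) hi (a i + j) (Nat.le_add_right _ _) (Nat.add_le_add_left (Nat.le_sub_one_of_lt hj) _)
  rwa [add_comm (a i) j, Function.iterate_add_apply T j (a i) (w (a i)), hw, add_comm j] at htrace

theorem TracesSpacedSpecifications.exists_tracing_off_gaps
    (hM : TracesSpacedSpecifications T ε M) (hsurj : Function.Surjective T) {L : ℕ} (hL : 0 < L)
    (x : ℕ → X) (z : X) (N₁ N₂ : ℕ) :
    ∃ y : X, (∀ k ≤ N₁, dist (T^[k] y) (T^[k] z) ≤ ε) ∧
      ∀ n, N₁ ≤ n → n < N₂ → M L ≤ (n - N₁) % (L + M L) →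
        ∃ a, ∃ j < L, a + j = n ∧ dist (T^[n] y) (T^[j] (x a)) ≤ ε := by
  obtain ⟨y, hinitial, hblocks⟩ := hM.exists_tracing_periodic_blocks hsurj hL x z N₁ N₂
  refine ⟨y, hinitial, fun n hn₁ hn₂ hgap => ?_⟩
  obtain ⟨j, hj⟩ := Nat.exists_eq_add_of_le hgap
  have hmod : (n - N₁) % (L + M L) < L + M L := Nat.mod_lt _ (by omega)
  have hdecomp := Nat.div_add_mod' (n - N₁) (L + M L)
  have hdiv : (n - N₁) / (L + M L) ≤ n - N₁ := Nat.div_le_self _ _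
  have hn : N₁ + (n - N₁) / (L + M L) * (L + M L) + M L + j = n := by omega
  have hblock := hblocks ((n - N₁) / (L + M L)) (by omega) j (by omega)
  rw [hn] at hblock
  exact ⟨_, j, by omega, hn, hblock⟩

end Tracing

/-- Every orbit can be modified after any sufficiently late time `N₁`, at the price of moving by at
most `ε` before that time, so as to follow `x` with average error at most `ε` up to any prescribed
time `N₂`. This is one stage of the construction of a shadowing point; the error is normalised by
the full time `N`, not by `N - N₁`. -/
def HasShadowingExtensions (T : X → X) (x : ℕ → X) : Prop :=
  ∀ ε : ℝ, 0 < ε → ∀ᶠ N₁ in atTop, ∀ (N₂ : ℕ) (z : X), ∃ y : X,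
    (∀ k ≤ N₁, dist (T^[k] y) (T^[k] z) ≤ ε) ∧
    ∀ N ∈ Set.Icc N₁ N₂, ∑ n ∈ Finset.Ico N₁ N, dist (T^[n] y) (x n) ≤ ε * N

variable [BoundedSpace X] {x : ℕ → X}

theorem exists_forall_sum_dist_iterate_le (hT : UniformContinuous T) (hsurj : Function.Surjective T)
    (hspec : HasWeakSpecification T) {ε : ℝ} (hε : 0 < ε) :
    ∃ A B : ℝ, ∀ (x : ℕ → X) (N₁ N₂ : ℕ) (z : X), ∃ y : X,
      (∀ k ≤ N₁, dist (T^[k] y) (T^[k] z) ≤ ε) ∧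
      ∀ N ∈ Set.Icc N₁ N₂, ∑ n ∈ Finset.Ico N₁ N, dist (T^[n] y) (x n) ≤
        3 * ε * N + (A + B * ∑ n ∈ Finset.range N, dist (T (x n)) (x (n + 1))) := by
  obtain ⟨D, hD_pos, hD⟩ := exists_pos_forall_dist_le X
  obtain ⟨M, -, hM_lim, hM⟩ : ∃ M : ℕ → ℕ, Monotone M ∧
      Tendsto (fun n : ℕ => (M n : ℝ) / n) atTop (𝓝 0) ∧ TracesSpacedSpecifications T ε M :=
    hspec ε hε
  obtain ⟨L, hgap, hL⟩ := ((hM_lim.eventually_le_const (show 0 < ε / D by positivity)).and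
    (eventually_gt_atTop 0)).exists
  rw [div_le_iff₀ (Nat.cast_pos.2 hL)] at hgap
  obtain ⟨C, hC, hwindow⟩ := exists_dist_iterate_le_add_mul_sum hT L hε
  refine ⟨D * M L, C * L, fun x N₁ N₂ z => ?_⟩
  obtain ⟨y, hinitial, htrace⟩ := hM.exists_tracing_off_gaps hsurj hL x z N₁ N₂
  refine ⟨y, hinitial, fun N hN => ?_⟩
  set e : ℕ → ℝ := fun n => dist (T (x n)) (x (n + 1))
  have he : ∀ n, 0 ≤ e n := fun n => dist_nonneg
  have hpointwise : ∀ n ∈ Finset.Ico N₁ N, dist (T^[n] y) (x n) ≤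
      2 * ε + (if (n - N₁) % (L + M L) < M L then D else 0) +
        C * ∑ i ∈ Finset.Ico (n - L) n, e i := by
    intro n hn
    rw [Finset.mem_Ico] at hn
    have hwindow_nonneg : 0 ≤ C * ∑ i ∈ Finset.Ico (n - L) n, e i :=
      mul_nonneg hC (Finset.sum_nonneg fun i _ => he i)
    split_ifs with hr
    · linarith [hD (T^[n] y) (x n)]
    · obtain ⟨a, j, hj, rfl, hclose⟩ := htrace n hn.1 (hn.2.trans_le hN.2) (not_lt.1 hr)
      have hsum : ∑ i ∈ Finset.Ico a (a + j), e i ≤ ∑ i ∈ Finset.Ico (a + j - L) (a + j), e i :=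
        Finset.sum_le_sum_of_subset_of_nonneg (Finset.Ico_subset_Ico_left (by omega))
          fun i _ _ => he i
      linarith [dist_triangle (T^[a + j] y) (T^[j] (x a)) (x (a + j)), hwindow x a j hj.le,
        mul_le_mul_of_nonneg_left hsum hC]
  calc ∑ n ∈ Finset.Ico N₁ N, dist (T^[n] y) (x n)
      ≤ 2 * ε * N + D * (ε / D * N + M L) + C * (L * ∑ n ∈ Finset.range N, e n) :=
        sum_Ico_le_of_forall_le_gap_add_window (by positivity) hC hD_pos.le (by positivity) hgap he
          hpointwise
    _ = 3 * ε * N + (D * M L + C * L * ∑ n ∈ Finset.range N, e n) := by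
        field_simp
        ring

theorem IsAsymptoticAveragePseudoOrbit.hasShadowingExtensions
    (hx : IsAsymptoticAveragePseudoOrbit T x) (hT : UniformContinuous T)
    (hsurj : Function.Surjective T) (hspec : HasWeakSpecification T) :
    HasShadowingExtensions T x := by
  intro ε hε
  obtain ⟨A, B, hAB⟩ := exists_forall_sum_dist_iterate_le hT hsurj hspec
    (show 0 < ε / 4 by positivity)
  have hsmall : (fun N : ℕ => A + B * ∑ n ∈ Finset.range N, dist (T (x n)) (x (n + 1)))
      =o[atTop] fun N : ℕ => (N : ℝ) :=
    ((isLittleO_const_id_atTop A).comp_tendsto tendsto_natCast_atTop_atTop).add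
      ((tendsto_average_iff_isLittleO.1 hx).const_mul_left B)
  filter_upwards [eventually_forall_ge_atTop.2 (hsmall.def (show 0 < ε / 4 by positivity))]
    with N₁ hN₁ N₂ z
  obtain ⟨y, hinitial, hsum⟩ := hAB x N₁ N₂ z
  refine ⟨y, fun k hk => (hinitial k hk).trans (by linarith), fun N hN => ?_⟩
  have hrest := (le_abs_self _).trans (hN₁ N hN.1)
  rw [Real.norm_natCast] at hrest
  linarith [hsum N hN]

theorem HasShadowingExtensions.exists_isAsymptoticallyShadowedInAverage [CompleteSpace X]
    (hx : HasShadowingExtensions T x) (hT : Continuous T) :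
    ∃ y : X, IsAsymptoticallyShadowedInAverage T x y := by
  obtain ⟨t, ht, hext, hgrow⟩ := exists_strictMono_forall_and_mul_le
    (fun k => hx ((1 / 2) ^ k) (by positivity)) fun k => 2 ^ k
  choose g hg_near hg_sum using fun k => hext k (t (k + 1))
  let z : ℕ → X := Nat.rec (x 0) g
  obtain ⟨y, hy⟩ := exists_forall_dist_iterate_le_of_dist_succ_le hT ht.monotone (z := z)
    fun k => hg_near k (z k)
  obtain ⟨D, -, hD⟩ := exists_pos_forall_dist_le X
  have hη : Tendsto (fun k : ℕ => 2 * (1 / 2 : ℝ) ^ k) atTop (𝓝 0) := by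
    simpa using (tendsto_pow_atTop_nhds_zero_of_lt_one (r := (1 / 2 : ℝ)) (by norm_num)
      (by norm_num)).const_mul 2
  refine ⟨y, tendsto_average_iff_isLittleO.2 (isLittleO_sum_range_of_sum_Ico_le
    (fun n => dist_nonneg) (fun n => hD _ _) ht hη (fun k => ?_) fun k N hN => ?_)⟩
  · have hgrow_k : (2 : ℝ) ^ k * t k ≤ t (k + 1) := mod_cast hgrow k
    calc (t k : ℝ) = (1 / 2) ^ k * (2 ^ k * t k) := by
          rw [← mul_assoc, ← mul_pow]
          norm_num
      _ ≤ (1 / 2) ^ k * t (k + 1) := by gcongr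
      _ ≤ 2 * (1 / 2) ^ k * t (k + 1) := by
          gcongr
          exact le_mul_of_one_le_left (by positivity) one_le_two
  · have hnear : ∀ n ∈ Finset.Ico (t k) N, dist (T^[n] y) (x n) ≤
        (1 / 2) ^ k + dist (T^[n] (z (k + 1))) (x n) := fun n hn => by
      have hn' := hy (k + 1) n ((Finset.mem_Ico.1 hn).2.le.trans hN.2)
      rw [pow_succ] at hn'
      linarith [dist_triangle_left (T^[n] y) (x n) (T^[n] (z (k + 1)))]
    have hcount : ((N - t k : ℕ) : ℝ) * (1 / 2) ^ k ≤ N * (1 / 2) ^ k := by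
      gcongr
      exact Nat.sub_le N (t k)
    have htotal := Finset.sum_le_sum hnear
    rw [Finset.sum_add_distrib, Finset.sum_const, Nat.card_Ico, nsmul_eq_mul] at htotal
    linarith [hg_sum k (z k) N hN]

end AverageShadowing

open AverageShadowing in
theorem mainTheorem3_general {X : Type*} [MetricSpace X] [CompleteSpace X] [BoundedSpace X]
    {T : X → X} (hT : UniformContinuous T) (hsurj : Function.Surjective T)
    (hspec : HasWeakSpecification T) : HasAsymptoticAverageShadowing T := fun _ hx =>
  (hx.hasShadowingExtensions hT hsurj hspec).exists_isAsymptoticallyShadowedInAverage hT.continuous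

theorem mainTheorem3 {X : Type*} [MetricSpace X] [CompactSpace X] (T : X → X)
    (hT : Continuous T) (hsurj : Function.Surjective T)
    (hspec : AverageShadowing.HasWeakSpecification T) :
    AverageShadowing.HasAsymptoticAverageShadowing T :=
  mainTheorem3_general (CompactSpace.uniformContinuous_of_continuous hT) hsurj hspec
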